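/- Let $K$ be a field of characteristic $0$ with algebraic closure $\overline K$. Let $X$ be a smooth $K$-variety (a smooth separated $K$-scheme of finite type, not necessarily irreducible), let $G$ be a commutative $K$-algebraic group (a commutative group scheme of finite type over $K$), and let $\varphi:X\to G$ be a $K$-morphism. The absolutely irreducible components of a $K$-variety $Y$ are the irreducible components $Y_i$ of $Y_{\overline K}$. Call $\varphi$ strongly generating if for every absolutely irreducible component $X_i$ of $X$ the image $\varphi_{\overline K}(X_i)$ is contained in no coset $gH$, where $H\subsetneq G_{\overline K}$ is a proper algebraic subgroup (closed subgroup scheme over $\overline K$) and $g\in G(\overline K)$. Call a $K$-morphism $\psi:Y\to G$ of $K$-varieties strongly dominant if for every absolutely irreducible component $Y_i$ of $Y$ the restriction $\psi_{\overline K}|_{Y_i}:Y_i\to G_{\overline K}$ is dominant. For $n\ge 1$ let $\varphi^{n}:X^{n}=X\times_K\cdots\times_K X\to G$, $\varphi^n(x_1,\dots,x_n)=\varphi(x_1)\cdots\varphi(x_n)$, be the $n$-th convolution power of $\varphi$. If $\varphi$ is strongly generating, then there exists an integer $n\ge 1$ such that $\varphi^{n}$ is strongly dominant. -/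

import Mathlib

open CategoryTheory AlgebraicGeometry MonoidalCategory CartesianMonoidalCategory MonObj

universe u

noncomputable section

namespace AlgConv

section Convolution

variable {S : Scheme.{u}}

/-- The convolution `φ * ψ : X × Y ⟶ G`, `(x, y) ↦ φ x · ψ y`, of two `S`-morphisms to a
group scheme `G` over `S`. (`⊗` is the fibre product over `S`.) -/
def conv {X Y G : Over S} [GrpObj G] (φ : X ⟶ G) (ψ : Y ⟶ G) : X ⊗ Y ⟶ G :=
  (φ ⊗ₘ ψ) ≫ μ[G]

/-- The `n`-fold fibre power `Xⁿ = X × ⋯ × X` over `S` (with `X⁰ = S`). -/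
def power (X : Over S) : ℕ → Over S
  | 0 => 𝟙_ (Over S)
  | n + 1 => power X n ⊗ X

/-- The `n`-th convolution power `φⁿ : Xⁿ ⟶ G`, `(x₁, …, xₙ) ↦ φ x₁ ⋯ φ xₙ`
(with `φ⁰` the neutral element). -/
def convPower {X G : Over S} [GrpObj G] (φ : X ⟶ G) : (n : ℕ) → (power X n ⟶ G)
  | 0 => η[G]
  | n + 1 => conv (convPower φ n) φ

end Convolution

section Field

variable (K : Type u) [Field K]

/-- The base change functor `X ↦ X_{K̄}` from `K`-schemes to `K̄`-schemes. -/
abbrev geom : Over (Spec (.of K)) ⥤ Over (Spec (.of (AlgebraicClosure K))) :=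
  Over.pullback (Spec.map (CommRingCat.ofHom (algebraMap K (AlgebraicClosure K))))

/-- The group structure on `G_{K̄}` obtained from that of `G` by base change. -/
instance geomGrpObj (G : Over (Spec (.of K))) [GrpObj G] : GrpObj ((geom K).obj G) :=
  Functor.grpObjObj

end Field

section Cosets

variable {S : Scheme.{u}}

/-- The underlying set of points of the left coset `g H` of a subgroup `i : H ⟶ G`,
`g` being an `S`-point of `G`: the image of `h ↦ g · i h`. -/
def cosetSet {G H : Over S} [GrpObj G] (i : H ⟶ G) (g : 𝟙_ (Over S) ⟶ G) : Set G.left :=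
  Set.range (lift (toUnit H ≫ g) i ≫ μ[G]).left

end Cosets

section Generating

variable {K : Type u} [Field K]

/-- The restriction of `φ : X ⟶ G` to the subset `Z` of `X_{K̄}` is generating: `φ(Z)` is
contained in no coset `g H` of a proper algebraic subgroup `H` (i.e. a closed subgroup scheme
`H ≠ G_{K̄}`) of `G_{K̄}`, with `g ∈ G(K̄)`. -/
def GeneratingOn {X G : Over (Spec (.of K))} [GrpObj G] (φ : X ⟶ G)
    (Z : Set ((geom K).obj X).left) : Prop :=
  ∀ (H : Over (Spec (.of (AlgebraicClosure K)))) [GrpObj H] (i : H ⟶ (geom K).obj G) [IsMonHom i]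
    [IsClosedImmersion i.left], ¬ IsIso i →
    ∀ g : 𝟙_ (Over (Spec (.of (AlgebraicClosure K)))) ⟶ (geom K).obj G,
      ¬ ((geom K).map φ).left '' Z ⊆ cosetSet i g

/-- `φ` is strongly generating: its restriction to every absolutely irreducible component of `X`
(an irreducible component of `X_{K̄}`) is generating. -/
def StronglyGenerating {X G : Over (Spec (.of K))} [GrpObj G] (φ : X ⟶ G) : Prop :=
  ∀ Z ∈ irreducibleComponents ((geom K).obj X).left, GeneratingOn φ Z

/-- `φ` is strongly dominant: its restriction `Z → Y_{K̄}` to every absolutely irreducible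
component `Z` of `X` has dense image. -/
def StronglyDominant {X Y : Over (Spec (.of K))} (φ : X ⟶ Y) : Prop :=
  ∀ Z ∈ irreducibleComponents ((geom K).obj X).left, Dense (((geom K).map φ).left '' Z)

end Generating

end AlgConv

end

/-! Work in the commutative group Γ of rational points of `G` over the algebraic closure, with its
Zariski topology. Translations are continuous, but multiplication is in general not jointly
continuous, so only separate continuity is used.

Let A ⊆ Γ be the image of a component and a ∈ A. Since B = a⁻¹A contains 1, the closures of the
powers Bⁿ form an ascending chain of irreducible closed sets through 1. It stabilises, because
primes of the Noetherian local ring at 1 have finite height. The limit is a closed submonoid, hence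
a subgroup by Noetherianity, and A lies in its coset by a. As A is generating, the limit is Γ and
some power of A is dense (`exists_dense_pow_of_isIrreducible`). The closed subgroups of Γ needed
here come from reduced closed subgroup schemes (`exists_closedSubgroupScheme`).

A component of Xⁿ contains the rational points of a product of n components of X. There are finitely
many components, so for large n one of them occurs often enough to make the image dense
(`exists_dense_list_prod`). -/

noncomputable section

namespace AlgConv

/-! ### Dense powers in Noetherian semitopological groups. -/

section SemitopologicalGroup

open Pointwise

/-- The image of a product of irreducible sets under a separately continuous map is irreducible. -/
theorem _root_.IsIrreducible.image2_of_separatelyContinuous {X Y P : Type*} [TopologicalSpace X]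
    [TopologicalSpace Y] [TopologicalSpace P] {m : X → Y → P} (hl : ∀ x, Continuous (m x))
    (hr : ∀ y, Continuous fun x ↦ m x y) {S : Set X} {T : Set Y} (hS : IsIrreducible S)
    (hT : IsIrreducible T) : IsIrreducible (Set.image2 m S T) := by
  refine ⟨hS.1.image2 hT.1, ?_⟩
  rintro u v hu hv ⟨_, ⟨x₁, hx₁, y₁, hy₁, rfl⟩, h₁⟩ ⟨_, ⟨x₂, hx₂, y₂, hy₂, rfl⟩, h₂⟩
  -- Irreducibility of `T` first yields one `y` serving both open sets, with `x₁`, `x₂` fixed; then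
  -- `x` varies with this `y` fixed.
  obtain ⟨y, hy, hyu, hyv⟩ := hT.2 _ _ (hu.preimage (hl x₁)) (hv.preimage (hl x₂))
    ⟨y₁, hy₁, h₁⟩ ⟨y₂, hy₂, h₂⟩
  obtain ⟨x, hx, hxu, hxv⟩ := hS.2 _ _ (hu.preimage (hr y)) (hv.preimage (hr y))
    ⟨x₁, hx₁, hyu⟩ ⟨x₂, hx₂, hyv⟩
  exact ⟨m x y, ⟨x, hx, y, hy, rfl⟩, hxu, hxv⟩

variable {Γ : Type*} [CommGroup Γ] [TopologicalSpace Γ] [ContinuousConstSMul Γ Γ]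

theorem _root_.IsIrreducible.mul_of_continuousConstSMul {S T : Set Γ} (hS : IsIrreducible S)
    (hT : IsIrreducible T) : IsIrreducible (S * T) :=
  hS.image2_of_separatelyContinuous (fun a ↦ continuous_const_smul a)
    (fun a ↦ by simpa only [smul_eq_mul, mul_comm] using continuous_const_smul (T := Γ) a) hT

theorem _root_.IsIrreducible.pow_of_continuousConstSMul {S : Set Γ} (hS : IsIrreducible S)
    (n : ℕ) : IsIrreducible (S ^ n) := by
  induction n with
  | zero => simpa using! isIrreducible_singleton (x := (1 : Γ))
  | succ n ih => rw [pow_succ]; exact ih.mul_of_continuousConstSMul hS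

/-- Without joint continuity the closures are taken one factor at a time, using translations and
commutativity. -/
theorem closure_mul_closure_subset_of_continuousConstSMul (S T : Set Γ) :
    closure S * closure T ⊆ closure (S * T) := by
  have key (S T : Set Γ) : S * closure T ⊆ closure (S * T) := by
    rw [Set.mul_subset_iff]
    intro s hs t ht
    refine closure_mono (Set.smul_set_subset_mul hs) ?_
    rw [closure_smul]
    exact Set.smul_mem_smul_set ht
  calc closure S * closure T ⊆ closure (closure S * T) := key _ _
    _ ⊆ closure (closure (T * S)) := by
      rw [mul_comm]; exact closure_mono (key _ _)
    _ = closure (S * T) := by rw [closure_closure, mul_comm]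

/-- A closed subsemigroup containing `1` of a Noetherian semitopological group is a subgroup. -/
theorem inv_mem_of_isClosed_of_noetherianSpace [TopologicalSpace.NoetherianSpace Γ]
    {Z : Submonoid Γ} (hZ : IsClosed (Z : Set Γ)) {z : Γ} (hz : z ∈ Z) : z⁻¹ ∈ Z := by
  -- Since `z • Z ⊆ Z`, the translates `z ^ n • Z` descend; where they stabilise, cancelling `z ^ N`
  -- exhibits the inverse of `z` inside `Z`.
  have hanti : Antitone fun n : ℕ ↦
      (⟨z ^ n • (Z : Set Γ), hZ.smul _⟩ : TopologicalSpace.Closeds Γ) := by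
    refine antitone_nat_of_succ_le fun n ↦ ?_
    rintro _ ⟨w, hw, rfl⟩
    exact ⟨z * w, Z.mul_mem hz hw, by
      simp only [smul_eq_mul, pow_succ, _root_.mul_assoc]⟩
  obtain ⟨N, hN⟩ := WellFoundedLT.antitone_chain_condition hanti
  have h : z ^ N • (Z : Set Γ) = z ^ (N + 1) • (Z : Set Γ) :=
    congr_arg (fun C : TopologicalSpace.Closeds Γ ↦ (C : Set Γ)) (hN (N + 1) N.le_succ)
  obtain ⟨w, hw, hwz⟩ : z ^ N ∈ z ^ (N + 1) • (Z : Set Γ) := h ▸ ⟨1, Z.one_mem, _root_.mul_one _⟩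
  have : z * w = 1 := by
    apply mul_left_cancel (a := z ^ N)
    simpa only [smul_eq_mul, pow_succ, _root_.mul_assoc, _root_.mul_one] using hwz
  rwa [inv_eq_of_mul_eq_one_right this]

/-- Some power of an irreducible subset contained in no coset of a proper closed subgroup is dense,
provided that the topology is Noetherian and ascending chains of irreducible closed subsets
containing `1` stabilise. -/
theorem exists_dense_pow_of_isIrreducible [TopologicalSpace.NoetherianSpace Γ]
    (hacc : ∀ Z : ℕ → Set Γ, Monotone Z → (∀ n, IsClosed (Z n)) → (∀ n, IsIrreducible (Z n)) →
      (∀ n, 1 ∈ Z n) → ∃ N, ∀ n ≥ N, Z N = Z n)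
    {A : Set Γ} (hA : IsIrreducible A)
    (hgen : ∀ H : Subgroup Γ, IsClosed (H : Set Γ) → H ≠ ⊤ → ∀ g : Γ, ¬ A ⊆ g • (H : Set Γ)) :
    ∃ N : ℕ, Dense (A ^ N) := by
  obtain ⟨a, ha⟩ := hA.1
  set B : Set Γ := a⁻¹ • A with hB
  have h1B : (1 : Γ) ∈ B := ⟨a, ha, by simp⟩
  have hBirr : IsIrreducible B := hA.image _ (continuous_const_smul a⁻¹).continuousOn
  obtain ⟨N, hN⟩ := hacc (fun n ↦ closure (B ^ n))
    (fun m n hmn ↦ closure_mono (Set.pow_subset_pow_right h1B hmn)) (fun _ ↦ isClosed_closure)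
    (fun n ↦ (hBirr.pow_of_continuousConstSMul n).closure)
    (fun n ↦ subset_closure (Set.one_mem_pow h1B))
  let Z : Submonoid Γ :=
    { carrier := closure (B ^ N)
      one_mem' := subset_closure (Set.one_mem_pow h1B)
      mul_mem' {x y} hx hy := by
        -- By stability the limit is also the closure of `B ^ (N + N)`, which absorbs products.
        rw [hN (N + N) (Nat.le_add_left N N), pow_add]
        exact closure_mul_closure_subset_of_continuousConstSMul _ _ (Set.mul_mem_mul hx hy) }
  let H : Subgroup Γ :=
    { Z with inv_mem' := inv_mem_of_isClosed_of_noetherianSpace (Z := Z) isClosed_closure }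
  have hBH : B ⊆ (H : Set Γ) := by
    change B ⊆ closure (B ^ N)
    rw [hN (N + 1) N.le_succ]
    refine subset_trans ?_ subset_closure
    simpa using Set.pow_subset_pow_right h1B (Nat.le_add_left 1 N)
  have hH : H = ⊤ := by
    by_contra hne
    refine hgen H isClosed_closure hne a ?_
    rwa [hB, Set.smul_set_subset_iff_subset_inv_smul_set, inv_inv] at hBH
  refine ⟨N, ?_⟩
  have hBN : Dense (B ^ N) := by
    rw [dense_iff_closure_eq]
    exact congr_arg (fun H : Subgroup Γ ↦ (H : Set Γ)) hH
  have := hBN.smul (a ^ N)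
  rwa [hB, smul_pow, inv_pow, smul_inv_smul] at this

end SemitopologicalGroup

/-! ### Pigeonhole for products of sets. -/

section ListProduct

open Pointwise

/-- In a product of sufficiently many members of a finite family of nonempty sets, each having a
dense power, one factor occurs often enough for the product to be dense. -/
theorem exists_dense_list_prod {Γ : Type*} [CommGroup Γ] [TopologicalSpace Γ]
    [ContinuousConstSMul Γ Γ] {I : Type*} [Finite I] (A : I → Set Γ) (hne : ∀ i, (A i).Nonempty)
    (hA : ∀ i, ∃ N : ℕ, Dense (A i ^ N)) :
    ∃ n : ℕ, 0 < n ∧ ∀ l : List I, l.length = n → Dense (l.map A).prod := by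
  classical
  have := Fintype.ofFinite I
  choose N hN using hA
  -- The `+ 1` gives positivity and makes the pigeonhole count strict even for empty `I`.
  refine ⟨∑ i, N i + 1, Nat.succ_pos _, fun l hl ↦ ?_⟩
  obtain ⟨i, hi⟩ : ∃ i, N i ≤ l.count i := by
    by_contra! h
    have h₁ : ∑ i, l.count i = l.length := by
      simpa using Multiset.sum_count_eq_card (s := Finset.univ) (m := (l : Multiset I)) (by simp)
    have h₂ : ∑ i, l.count i ≤ ∑ i, N i := Finset.sum_le_sum fun i _ ↦ (h i).le
    omega
  have hprod : (l.map A).prod = ∏ j, A j ^ l.count j := by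
    rw [Finset.prod_list_map_count]
    exact Finset.prod_subset (Finset.subset_univ _) fun j _ hj ↦ by
      rw [List.count_eq_zero_of_not_mem (by simpa using hj), pow_zero]
  -- One point `c` of the remaining factors suffices: the product contains the dense translate `c •
  -- A i ^ N i`.
  obtain ⟨c, hc⟩ : (A i ^ (l.count i - N i) *
      ∏ j ∈ Finset.univ.erase i, A j ^ l.count j).Nonempty := by
    refine (Set.Nonempty.pow (hne i)).mul ?_
    refine Finset.prod_induction _ Set.Nonempty (fun _ _ ↦ Set.Nonempty.mul) Set.one_nonempty
      fun j _ ↦ (hne j).pow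
  rw [hprod, ← Finset.mul_prod_erase _ _ (Finset.mem_univ i), ← Nat.add_sub_of_le hi, pow_add,
    _root_.mul_assoc]
  refine ((hN i).smul c).mono ?_
  rw [mul_comm]
  exact Set.smul_set_subset_mul hc

end ListProduct

/-! ### Rational points and their Zariski topology. -/

section Points

variable {k : Type u} [Field k]

/-- The point of the underlying space of `X` which is the image of a `k`-point. -/
def evalPoint {X : Over (Spec (.of k))} (p : 𝟙_ (Over (Spec (.of k))) ⟶ X) : X.left :=
  p.left (IsLocalRing.closedPoint k : Spec (.of k))

/-- The Zariski topology on the set of `k`-points of a `k`-scheme. -/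
instance pointsTopology (X : Over (Spec (.of k))) :
    TopologicalSpace (𝟙_ (Over (Spec (.of k))) ⟶ X) :=
  .induced evalPoint inferInstance

theorem isInducing_evalPoint (X : Over (Spec (.of k))) :
    Topology.IsInducing (evalPoint (X := X)) := ⟨rfl⟩

theorem evalPoint_comp {X Y : Over (Spec (.of k))} (p : 𝟙_ (Over (Spec (.of k))) ⟶ X)
    (f : X ⟶ Y) : evalPoint (p ≫ f) = f.left (evalPoint p) := by
  rfl

theorem continuous_comp_points {X Y : Over (Spec (.of k))} (f : X ⟶ Y) :
    Continuous fun p : 𝟙_ (Over (Spec (.of k))) ⟶ X ↦ p ≫ f := by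
  rw [(isInducing_evalPoint Y).continuous_iff]
  convert! f.left.continuous.comp (isInducing_evalPoint X).continuous using 1

variable [IsAlgClosed k]

theorem isClosed_evalPoint {X : Over (Spec (.of k))} [LocallyOfFiniteType X.hom]
    (p : 𝟙_ (Over (Spec (.of k))) ⟶ X) : IsClosed {evalPoint p} :=
  (pointEquivClosedPoint X.hom ⟨p.left, Over.w p⟩).2

theorem exists_evalPoint_eq {X : Over (Spec (.of k))} [LocallyOfFiniteType X.hom] {x : X.left}
    (hx : IsClosed {x}) : ∃ p : 𝟙_ (Over (Spec (.of k))) ⟶ X, evalPoint p = x :=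
  ⟨Over.homMk (pointOfClosedPoint X.hom x hx) (pointOfClosedPoint_comp X.hom x hx),
    pointOfClosedPoint_apply X.hom x hx _⟩

theorem evalPoint_injective (X : Over (Spec (.of k))) [LocallyOfFiniteType X.hom] :
    Function.Injective (evalPoint (X := X)) := fun p q h ↦
  Over.OverMorphism.ext (ext_of_apply_closedPoint_eq X.hom (Over.w p) (Over.w q) h)

/-- Locally closed subsets of schemes locally of finite type over an algebraically closed field
have rational points. -/
theorem exists_evalPoint_mem {X : Over (Spec (.of k))} [LocallyOfFiniteType X.hom]
    {Z : Set X.left} (hZ : IsLocallyClosed Z) (hne : Z.Nonempty) :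
    ∃ p : 𝟙_ (Over (Spec (.of k))) ⟶ X, evalPoint p ∈ Z := by
  have : JacobsonSpace X.left := LocallyOfFiniteType.jacobsonSpace X.hom
  obtain ⟨x, hx, hx'⟩ := nonempty_inter_closedPoints hne hZ
  obtain ⟨p, rfl⟩ := exists_evalPoint_eq hx'
  exact ⟨p, hx⟩

/-- Every nonempty locally closed set has a rational point, so closed sets are determined by their
rational points. -/
theorem closure_image_evalPoint_preimage {X : Over (Spec (.of k))} [LocallyOfFiniteType X.hom]
    {Z : Set X.left} (hZ : IsClosed Z) : closure (evalPoint '' (evalPoint ⁻¹' Z)) = Z := by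
  refine (closure_minimal (Set.image_preimage_subset _ _) hZ).antisymm fun x hx ↦ ?_
  rw [mem_closure_iff]
  intro U hU hxU
  obtain ⟨p, hpU, hpZ⟩ := exists_evalPoint_mem (hU.isLocallyClosed.inter hZ.isLocallyClosed)
    ⟨x, hxU, hx⟩
  exact ⟨_, hpU, p, hpZ, rfl⟩

theorem dense_image_evalPoint {X : Over (Spec (.of k))} [LocallyOfFiniteType X.hom]
    {S : Set (𝟙_ (Over (Spec (.of k))) ⟶ X)} (hS : Dense S) : Dense (evalPoint '' S) := by
  have h : DenseRange (evalPoint (X := X)) := by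
    rw [DenseRange, dense_iff_closure_eq, ← closure_image_evalPoint_preimage isClosed_univ,
      Set.preimage_univ, Set.image_univ]
  exact h.dense_image (isInducing_evalPoint X).continuous hS

theorem isIrreducible_preimage_evalPoint {X : Over (Spec (.of k))} [LocallyOfFiniteType X.hom]
    {Z : Set X.left} (hZ : IsClosed Z) (hirr : IsIrreducible Z) :
    IsIrreducible (evalPoint (X := X) ⁻¹' Z) := by
  refine ⟨exists_evalPoint_mem hZ.isLocallyClosed hirr.1, ?_⟩
  intro U V hU hV hZU hZV
  obtain ⟨U, hU', rfl⟩ := (isInducing_evalPoint X).isOpen_iff.mp hU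
  obtain ⟨V, hV', rfl⟩ := (isInducing_evalPoint X).isOpen_iff.mp hV
  obtain ⟨p, hpZ, hpU⟩ := hZU
  obtain ⟨q, hqZ, hqV⟩ := hZV
  exact exists_evalPoint_mem (hZ.isLocallyClosed.inter (hU'.inter hV').isLocallyClosed)
    (hirr.2 U V hU' hV' ⟨_, hpZ, hpU⟩ ⟨_, hqZ, hqV⟩)

/-- Every irreducible component of `X × Y` contains the rational points of a product of an
irreducible component of `X` and one of `Y`. -/
theorem exists_irreducibleComponents_lift_mem {X Y : Over (Spec (.of k))}
    [LocallyOfFiniteType X.hom] [LocallyOfFiniteType Y.hom]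
    {Z : Set (X ⊗ Y).left} (hZ : Z ∈ irreducibleComponents (X ⊗ Y).left) :
    ∃ A ∈ irreducibleComponents X.left, ∃ B ∈ irreducibleComponents Y.left,
      ∀ p q, evalPoint p ∈ A → evalPoint q ∈ B → evalPoint (lift p q) ∈ Z := by
  have : LocallyOfFiniteType (X ⊗ Y).hom := by dsimp; infer_instance
  obtain ⟨A, hA, hZA⟩ := exists_mem_irreducibleComponents_subset_of_isIrreducible _
    (hZ.1.image (fst X Y).left (fst X Y).left.continuous.continuousOn)
  obtain ⟨B, hB, hZB⟩ := exists_mem_irreducibleComponents_subset_of_isIrreducible _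
    (hZ.1.image (snd X Y).left (snd X Y).left.continuous.continuousOn)
  refine ⟨A, hA, B, hB, ?_⟩
  have hbox : IsIrreducible (Set.image2 (fun p q ↦ lift p q)
      (evalPoint (X := X) ⁻¹' A) (evalPoint (X := Y) ⁻¹' B)) := by
    refine IsIrreducible.image2_of_separatelyContinuous (fun p ↦ ?_) (fun q ↦ ?_)
      (isIrreducible_preimage_evalPoint (isClosed_of_mem_irreducibleComponents A hA) hA.1)
      (isIrreducible_preimage_evalPoint (isClosed_of_mem_irreducibleComponents B hB) hB.1)
    · convert! continuous_comp_points (lift (toUnit Y ≫ p) (𝟙 Y)) using 2 with q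
      ext1 <;> simp
    · convert! continuous_comp_points (lift (𝟙 X) (toUnit X ≫ q)) using 2 with p
      ext1 <;> simp
  -- The closure of the box is irreducible and contains `Z`, so maximality of `Z` forces it into
  -- `Z`.
  have hW := (hbox.image evalPoint (isInducing_evalPoint _).continuous.continuousOn).closure
  have hsub : Z ⊆ closure (evalPoint '' Set.image2 (fun p q ↦ lift p q)
      (evalPoint (X := X) ⁻¹' A) (evalPoint (X := Y) ⁻¹' B)) := by
    rw [← closure_image_evalPoint_preimage (isClosed_of_mem_irreducibleComponents Z hZ)]
    refine closure_mono (Set.image_mono fun r hr ↦ ⟨r ≫ fst X Y, ?_, r ≫ snd X Y, ?_, ?_⟩)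
    · exact hZA ⟨_, hr, (evalPoint_comp r _).symm⟩
    · exact hZB ⟨_, hr, (evalPoint_comp r _).symm⟩
    · ext1 <;> simp
  intro p q hp hq
  exact hZ.2 hW hsub (subset_closure ⟨_, ⟨p, hp, q, hq, rfl⟩, rfl⟩)

end Points

/-! ### Ascending chains of irreducible closed sets. -/

section Chains

/-- Primes of a Noetherian ring have finite height, so height is strictly monotone into a
well-order. -/
theorem _root_.PrimeSpectrum.wellFoundedLT_of_isNoetherianRing (R : Type*) [CommRing R]
    [IsNoetherianRing R] : WellFoundedLT (PrimeSpectrum R) :=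
  StrictMono.wellFoundedLT (f := fun p : PrimeSpectrum R ↦ p.asIdeal.height) fun p q hpq ↦
    Ideal.height_strict_mono_of_isPrime (I := p.asIdeal) (J := q.asIdeal) hpq

/-- On a locally Noetherian scheme, ascending chains of irreducible closed subsets through a given
point stabilise. -/
theorem exists_forall_ge_eq_of_isIrreducible_of_mem {X : Scheme.{u}} [IsLocallyNoetherian X]
    (x : X) (Z : ℕ → Set X) (hmono : Monotone Z) (hcl : ∀ n, IsClosed (Z n))
    (hirr : ∀ n, IsIrreducible (Z n)) (hx : ∀ n, x ∈ Z n) : ∃ N, ∀ n ≥ N, Z N = Z n := by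
  choose y hy using fun n ↦
    Exists.intro (p := fun y ↦ closure {y} = Z n) _ ((hirr n).closure_genericPoint (hcl n))
  -- The generic points specialise to `x`, hence are primes of the local ring at `x`; larger closed
  -- sets give smaller primes.
  have hrange (n : ℕ) : y n ∈ Set.range (X.fromSpecStalk x) := by
    rw [Scheme.range_fromSpecStalk]
    refine specializes_iff_mem_closure.mpr ?_
    rw [hy]
    exact hx n
  choose P hP using hrange
  have hanti : Antitone (α := ℕ) (β := PrimeSpectrum (X.presheaf.stalk x)) P := by
    intro m n hmn
    refine (PrimeSpectrum.le_iff_specializes (R := X.presheaf.stalk x) _ _).mpr ?_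
    refine ((X.fromSpecStalk x).isEmbedding.isInducing.specializes_iff).mp ?_
    rw [hP, hP, specializes_iff_mem_closure, hy]
    exact hmono hmn (hy m ▸ subset_closure rfl)
  have := PrimeSpectrum.wellFoundedLT_of_isNoetherianRing (X.presheaf.stalk x)
  obtain ⟨N, hN⟩ := WellFoundedLT.antitone_chain_condition hanti
  refine ⟨N, fun n hn ↦ ?_⟩
  rw [← hy, ← hy, ← hP, ← hP, hN n hn]

end Chains

/-! ### Topology of the group of rational points. -/

section GroupPoints

variable {k : Type u} [Field k]

instance (G : Over (Spec (.of k))) [GrpObj G] :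
    ContinuousConstSMul (𝟙_ (Over (Spec (.of k))) ⟶ G) (𝟙_ (Over (Spec (.of k))) ⟶ G) where
  continuous_const_smul g := by
    convert! continuous_comp_points (lift (toUnit G ≫ g) (𝟙 G) ≫ μ[G]) using 2 with p
    rw [smul_eq_mul, Hom.mul_def, ← Category.assoc, comp_lift, Category.comp_id,
      ← Category.assoc, toUnit_unique (p ≫ toUnit G) (𝟙 _), Category.id_comp]

theorem isNoetherian_of_locallyOfFiniteType (X : Over (Spec (.of k)))
    [LocallyOfFiniteType X.hom] [QuasiCompact X.hom] : IsNoetherian X.left where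
  __ := LocallyOfFiniteType.isLocallyNoetherian X.hom
  __ := QuasiCompact.compactSpace_of_compactSpace X.hom

instance (X : Over (Spec (.of k))) [LocallyOfFiniteType X.hom] [QuasiCompact X.hom] :
    TopologicalSpace.NoetherianSpace (𝟙_ (Over (Spec (.of k))) ⟶ X) :=
  have := isNoetherian_of_locallyOfFiniteType X
  (isInducing_evalPoint X).noetherianSpace

theorem exists_forall_ge_eq_of_isIrreducible_points {X : Over (Spec (.of k))}
    [LocallyOfFiniteType X.hom] (p : 𝟙_ (Over (Spec (.of k))) ⟶ X)
    (Z : ℕ → Set (𝟙_ (Over (Spec (.of k))) ⟶ X)) (hmono : Monotone Z)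
    (hcl : ∀ n, IsClosed (Z n)) (hirr : ∀ n, IsIrreducible (Z n)) (hp : ∀ n, p ∈ Z n) :
    ∃ N, ∀ n ≥ N, Z N = Z n := by
  have := LocallyOfFiniteType.isLocallyNoetherian X.hom
  obtain ⟨N, hN⟩ := exists_forall_ge_eq_of_isIrreducible_of_mem (evalPoint p)
    (fun n ↦ closure (evalPoint '' Z n)) (fun m n h ↦ closure_mono (Set.image_mono (hmono h)))
    (fun n ↦ isClosed_closure)
    (fun n ↦ ((hirr n).image _ (isInducing_evalPoint X).continuous.continuousOn).closure)
    (fun n ↦ subset_closure ⟨p, hp n, rfl⟩)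
  refine ⟨N, fun n hn ↦ ?_⟩
  rw [← (hcl N).closure_eq, ← (hcl n).closure_eq,
    (isInducing_evalPoint X).closure_eq_preimage_closure_image, hN n hn,
    (isInducing_evalPoint X).closure_eq_preimage_closure_image]

end GroupPoints

/-! ### Products of reduced schemes over an algebraically closed field. -/

section Reduced

open TensorProduct

/-- A reduced algebra of finite type over an algebraically closed field embeds into the product of
its rational points. -/
theorem eq_zero_of_forall_algHom_eq_zero {k A : Type*} [Field k] [IsAlgClosed k] [CommRing A]
    [Algebra k A] [Algebra.FiniteType k A] [_root_.IsReduced A] {a : A}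
    (ha : ∀ f : A →ₐ[k] k, f a = 0) : a = 0 := by
  have : IsJacobsonRing A := isJacobsonRing_of_finiteType (A := k)
  have h : a ∈ (⊥ : Ideal A).jacobson := by
    refine Ideal.mem_sInf.mpr fun {M} hM ↦ ?_
    have := hM.2
    let := Ideal.Quotient.field M
    have : Algebra.FiniteType k (A ⧸ M) :=
      .of_surjective (Ideal.Quotient.mkₐ k M) (Ideal.Quotient.mkₐ_surjective k M)
    have := finite_of_finite_type_of_isJacobsonRing k (A ⧸ M)
    let e : k ≃ₐ[k] A ⧸ M := AlgEquiv.ofBijective (Algebra.ofId k (A ⧸ M))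
      IsAlgClosed.algebraMap_bijective_of_isIntegral
    have := ha (e.symm.toAlgHom.comp (Ideal.Quotient.mkₐ k M))
    exact Ideal.Quotient.eq_zero_iff_mem.mp ((map_eq_zero_iff e.symm e.symm.injective).mp this)
  rw [← Ideal.radical_eq_jacobson] at h
  exact (show IsNilpotent a from h).eq_zero

/-- Expand a nilpotent in a `k`-basis of `B`. Specialising `A` at a rational point sends it to a
nilpotent of `B`, i.e. to zero, so its coordinates vanish at all rational points of `A`. -/
theorem isReduced_tensorProduct_of_isAlgClosed {k A B : Type*} [Field k] [IsAlgClosed k]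
    [CommRing A] [CommRing B] [Algebra k A] [Algebra k B] [Algebra.FiniteType k A]
    [_root_.IsReduced A] [_root_.IsReduced B] : _root_.IsReduced (A ⊗[k] B) where
  eq_zero z hz := by
    let b := Module.Basis.ofVectorSpace k B
    refine (b.baseChange A).repr.map_eq_zero_iff.mp (Finsupp.ext fun i ↦
      eq_zero_of_forall_algHom_eq_zero (k := k) fun f ↦ ?_)
    let ψ : A ⊗[k] B →ₐ[k] B := Algebra.TensorProduct.lift ((Algebra.ofId k B).comp f)
      (AlgHom.id k B) fun _ _ ↦ .all _ _
    have key (w : A ⊗[k] B) : f ((b.baseChange A).repr w i) = b.repr (ψ w) i := by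
      induction w with
      | zero => simp
      | tmul x y =>
        have : ψ (x ⊗ₜ y) = f x • y := by simp [ψ, Algebra.ofId_apply, Algebra.smul_def]
        simp [this, mul_comm]
      | add x y hx hy => simp [hx, hy]
    rw [key, (hz.map ψ).eq_zero]
    simp

theorem isReduced_pullback_of_isAlgClosed {k : Type u} [Field k] [IsAlgClosed k]
    {X Y : Scheme.{u}} (f : X ⟶ Spec (.of k)) (g : Y ⟶ Spec (.of k)) [LocallyOfFiniteType f]
    [IsReduced X] [IsReduced Y] : IsReduced (Limits.pullback f g) := by
  have affine (A B : CommRingCat.{u}) (f : Spec A ⟶ Spec (.of k)) (g : Spec B ⟶ Spec (.of k))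
      [LocallyOfFiniteType f] [IsReduced (Spec A)] [IsReduced (Spec B)] :
      IsReduced (Limits.pullback f g) := by
    obtain ⟨φ, rfl⟩ := Spec.map_surjective f
    obtain ⟨ψ, rfl⟩ := Spec.map_surjective g
    algebraize [φ.hom, ψ.hom]
    have : Algebra.FiniteType k A :=
      (HasRingHomProperty.Spec_iff (P := @LocallyOfFiniteType) (φ := φ)).mp ‹_›
    have : _root_.IsReduced A := (affine_isReduced_iff A).mp ‹_›
    have : _root_.IsReduced B := (affine_isReduced_iff B).mp ‹_›
    have : _root_.IsReduced (A ⊗[k] B) := isReduced_tensorProduct_of_isAlgClosed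
    have : IsReduced (Spec (CommRingCat.of (A ⊗[k] B))) := (affine_isReduced_iff _).mpr ‹_›
    exact isReduced_of_isOpenImmersion (pullbackSpecIso k A B).hom
  refine @IsReduced.of_openCover _
    (Scheme.Pullback.openCoverOfLeftRight X.affineCover Y.affineCover f g) fun i ↦ ?_
  have : IsReduced (X.affineCover.X i.1) := isReduced_of_isOpenImmersion (X.affineCover.f i.1)
  have : IsReduced (Y.affineCover.X i.2) := isReduced_of_isOpenImmersion (Y.affineCover.f i.2)
  have : LocallyOfFiniteType (X.affineCover.f i.1 ≫ f) :=
    MorphismProperty.comp_mem _ _ _ inferInstance inferInstance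
  exact @affine _ _ (X.affineCover.f i.1 ≫ f) (Y.affineCover.f i.2 ≫ g) ‹_› ‹_› ‹_›

theorem isReduced_subscheme_vanishingIdeal {X : Scheme.{u}} (Z : TopologicalSpace.Closeds X) :
    IsReduced (Scheme.IdealSheafData.vanishingIdeal Z).subscheme := by
  refine @IsReduced.of_openCover _
    (Scheme.IdealSheafData.vanishingIdeal Z).subschemeCover.openCover fun U ↦ ?_
  refine (affine_isReduced_iff _).mpr ?_
  exact (Ideal.isRadical_iff_quotient_reduced _).mp (PrimeSpectrum.isRadical_vanishingIdeal _)

end Reduced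

/-! ### Subgroup objects. -/

section GroupObject

/-- The group structure on a subobject `i : H ⟶ G` of a group object through which the neutral
element, the multiplication and the inversion of `G` factor. -/
abbrev grpObjOfMono {C : Type*} [Category C] [CartesianMonoidalCategory C] {G H : C} [GrpObj G]
    (i : H ⟶ G) [Mono i] {e : 𝟙_ C ⟶ H} {m : H ⊗ H ⟶ H} {v : H ⟶ H} (he : e ≫ i = η[G])
    (hm : m ≫ i = (i ⊗ₘ i) ≫ μ[G]) (hv : v ≫ i = i ≫ ι[G]) : GrpObj H where
  one := e
  mul := m
  inv := v
  one_mul := by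
    rw [← cancel_mono i, Category.assoc, hm, whiskerRight_comp_tensorHom_assoc, he, one_mul_hom]
  mul_one := by
    rw [← cancel_mono i, Category.assoc, hm, whiskerLeft_comp_tensorHom_assoc, he, mul_one_hom]
  mul_assoc := by
    rw [← cancel_mono i, Category.assoc, Category.assoc, Category.assoc, hm,
      whiskerRight_comp_tensorHom_assoc, whiskerLeft_comp_tensorHom_assoc, hm]
    calc (((i ⊗ₘ i) ≫ μ[G]) ⊗ₘ i) ≫ μ[G]
        = ((i ⊗ₘ i) ⊗ₘ i) ≫ μ[G] ▷ G ≫ μ[G] := by rw [tensorHom_comp_whiskerRight_assoc]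
      _ = (α_ H H H).hom ≫ (i ⊗ₘ i ⊗ₘ i) ≫ G ◁ μ[G] ≫ μ[G] := by
        rw [MonObj.mul_assoc, associator_naturality_assoc]
      _ = (α_ H H H).hom ≫ (i ⊗ₘ (i ⊗ₘ i) ≫ μ[G]) ≫ μ[G] := by
        rw [tensorHom_comp_whiskerLeft_assoc]
  left_inv := by
    rw [← cancel_mono i, Category.assoc, Category.assoc, hm, he, lift_map_assoc, hv,
      Category.id_comp]
    calc lift (i ≫ ι[G]) i ≫ μ[G] = i ≫ lift ι[G] (𝟙 G) ≫ μ[G] := by simp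
      _ = toUnit H ≫ η[G] := by rw [GrpObj.left_inv, ← Category.assoc, comp_toUnit]
  right_inv := by
    rw [← cancel_mono i, Category.assoc, Category.assoc, hm, he, lift_map_assoc, hv,
      Category.id_comp]
    calc lift i (i ≫ ι[G]) ≫ μ[G] = i ≫ lift (𝟙 G) ι[G] ≫ μ[G] := by simp
      _ = toUnit H ≫ η[G] := by rw [GrpObj.right_inv, ← Category.assoc, comp_toUnit]

end GroupObject

/-! ### From closed subgroups of points to closed subgroup schemes. -/

section Subgroup

variable {k : Type u} [Field k]

/-- The reduced closed subscheme whose rational points are the elements of a closed set `S` of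
rational points. -/
def closedSubscheme (G : Over (Spec (.of k))) (S : Set (𝟙_ (Over (Spec (.of k))) ⟶ G)) :
    Over (Spec (.of k)) :=
  Over.mk ((Scheme.IdealSheafData.vanishingIdeal
    ⟨closure (evalPoint '' S), isClosed_closure⟩).subschemeι ≫ G.hom)

/-- The inclusion of `closedSubscheme G S` into `G`. -/
def closedSubschemeι (G : Over (Spec (.of k))) (S : Set (𝟙_ (Over (Spec (.of k))) ⟶ G)) :
    closedSubscheme G S ⟶ G :=
  Over.homMk (Scheme.IdealSheafData.vanishingIdeal
    ⟨closure (evalPoint '' S), isClosed_closure⟩).subschemeι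

variable {G : Over (Spec (.of k))} {S : Set (𝟙_ (Over (Spec (.of k))) ⟶ G)}

instance : IsReduced (closedSubscheme G S).left := isReduced_subscheme_vanishingIdeal _

instance : IsClosedImmersion (closedSubschemeι G S).left :=
  inferInstanceAs (IsClosedImmersion (Scheme.IdealSheafData.subschemeι _))

instance : Mono (closedSubschemeι G S) := (Over.forget _).mono_of_mono_map
  (inferInstanceAs (Mono (closedSubschemeι G S).left))

instance [LocallyOfFiniteType G.hom] : LocallyOfFiniteType (closedSubscheme G S).hom :=
  inferInstanceAs (LocallyOfFiniteType (Scheme.IdealSheafData.subschemeι _ ≫ G.hom))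

theorem range_closedSubschemeι :
    Set.range (closedSubschemeι G S).left = closure (evalPoint '' S) :=
  (Scheme.IdealSheafData.range_subschemeι _).trans
    (Scheme.IdealSheafData.coe_support_vanishingIdeal _)

theorem comp_closedSubschemeι_mem (hS : IsClosed S)
    (q : 𝟙_ (Over (Spec (.of k))) ⟶ closedSubscheme G S) : q ≫ closedSubschemeι G S ∈ S := by
  suffices q ≫ closedSubschemeι G S ∈ closure S by rwa [hS.closure_eq] at this
  rw [(isInducing_evalPoint G).closure_eq_preimage_closure_image, ← range_closedSubschemeι,
    Set.mem_preimage, evalPoint_comp]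
  exact ⟨_, rfl⟩

variable [IsAlgClosed k] [LocallyOfFiniteType G.hom]

theorem exists_comp_closedSubschemeι_eq {p : 𝟙_ (Over (Spec (.of k))) ⟶ G} (hp : p ∈ S) :
    ∃ q, q ≫ closedSubschemeι G S = p := by
  obtain ⟨x, hx⟩ : evalPoint p ∈ Set.range (closedSubschemeι G S).left := by
    rw [range_closedSubschemeι]
    exact subset_closure ⟨p, hp, rfl⟩
  have hcl : IsClosed {x} := by
    convert! (isClosed_evalPoint p).preimage (closedSubschemeι G S).left.continuous
    ext y
    rw [Set.mem_preimage, ← hx, Set.mem_singleton_iff, Set.mem_singleton_iff]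
    exact (closedSubschemeι G S).left.isClosedEmbedding.injective.eq_iff.symm
  obtain ⟨q, rfl⟩ := exists_evalPoint_eq hcl
  exact ⟨q, evalPoint_injective G ((evalPoint_comp q _).trans hx)⟩

/-- A morphism from a reduced scheme which maps rational points into `S` factors through the
reduced closed subscheme defined by `S`. -/
theorem exists_lift_closedSubscheme {T : Over (Spec (.of k))} [LocallyOfFiniteType T.hom]
    [IsReduced T.left] (f : T ⟶ G) (hf : ∀ t, t ≫ f ∈ S) :
    ∃ g, g ≫ closedSubschemeι G S = f := by
  -- The base change `π` of the inclusion is a closed immersion hitting all rational points of the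
  -- reduced `T`, hence an isomorphism; its inverse gives the factorisation.
  let π := Limits.pullback.snd (closedSubschemeι G S).left f.left
  have hdense : Set.range π = Set.univ := by
    rw [← π.isClosedEmbedding.isClosed_range.closure_eq, ← dense_iff_closure_eq]
    refine (dense_image_evalPoint (X := T) dense_univ).mono ?_
    rintro _ ⟨t, -, rfl⟩
    obtain ⟨q, hq⟩ := exists_comp_closedSubschemeι_eq (hf t)
    refine ⟨(Limits.pullback.lift q.left t.left (by
      rw [← Over.comp_left, hq, Over.comp_left])) (IsLocalRing.closedPoint k : Spec (.of k)), ?_⟩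
    exact (Scheme.Hom.comp_apply _ _ _).symm.trans (congr_arg
      (fun j : Spec (.of k) ⟶ T.left ↦ j (IsLocalRing.closedPoint k : Spec (.of k)))
      (Limits.pullback.lift_snd _ _ _))
  have : Surjective π := ⟨Set.range_eq_univ.mp hdense⟩
  have : IsIso π := isIso_of_isClosedImmersion_of_surjective π
  have h : (inv π ≫ Limits.pullback.fst _ _) ≫ (closedSubschemeι G S).left = f.left := by
    rw [Category.assoc, Limits.pullback.condition, IsIso.inv_hom_id_assoc]
  refine ⟨Over.homMk (inv π ≫ Limits.pullback.fst _ _) ?_, Over.OverMorphism.ext h⟩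
  rw [← Over.w (closedSubschemeι G S), ← Category.assoc, h, Over.w f]

theorem isReduced_tensorObj (X Y : Over (Spec (.of k))) [LocallyOfFiniteType X.hom]
    [IsReduced X.left] [IsReduced Y.left] : IsReduced (X ⊗ Y).left :=
  isReduced_pullback_of_isAlgClosed X.hom Y.hom

/-- A closed subgroup of the group of rational points is the group of rational points of a closed
subgroup scheme. -/
theorem exists_closedSubgroupScheme [GrpObj G]
    (H : Subgroup (𝟙_ (Over (Spec (.of k))) ⟶ G)) (hH : IsClosed (H : Set (𝟙_ _ ⟶ G))) :
    ∃ (H' : Over (Spec (.of k))) (_ : GrpObj H') (i : H' ⟶ G), IsMonHom i ∧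
      IsClosedImmersion i.left ∧ ∀ p, p ∈ H ↔ ∃ q, q ≫ i = p := by
  set S : Set (𝟙_ (Over (Spec (.of k))) ⟶ G) := (H : Set (𝟙_ _ ⟶ G))
  set i := closedSubschemeι G S
  have hi := comp_closedSubschemeι_mem hH
  have : LocallyOfFiniteType (closedSubscheme G S ⊗ closedSubscheme G S).hom := by
    dsimp; infer_instance
  have := isReduced_tensorObj (closedSubscheme G S) (closedSubscheme G S)
  obtain ⟨e, he⟩ := exists_comp_closedSubschemeι_eq (S := S) H.one_mem
  rw [← one_eq_one] at he
  obtain ⟨m, hm⟩ := exists_lift_closedSubscheme (S := S) ((i ⊗ₘ i) ≫ μ[G]) fun t ↦ by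
    have : t ≫ (i ⊗ₘ i) ≫ μ[G] = (t ≫ fst _ _ ≫ i) * (t ≫ snd _ _ ≫ i) := by
      rw [Hom.mul_def, ← Category.assoc]
      congr 1
      ext1 <;> simp
    rw [this]
    exact H.mul_mem (Category.assoc t (fst _ _) i ▸ hi (t ≫ fst _ _)) (Category.assoc t (snd _ _) i ▸ hi (t ≫ snd _ _))
  obtain ⟨v, hv⟩ := exists_lift_closedSubscheme (S := S) (i ≫ ι[G]) fun t ↦ by
    rw [← Category.assoc, ← Hom.inv_def]
    exact H.inv_mem (hi t)
  let := grpObjOfMono i he hm hv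
  refine ⟨closedSubscheme G S, this, i, { one_hom := he, mul_hom := hm }, inferInstance, fun p ↦
    ⟨exists_comp_closedSubschemeι_eq, ?_⟩⟩
  rintro ⟨q, rfl⟩
  exact hi q

end Subgroup

/-! ### Convolution powers over an algebraically closed field. -/

section ConvPower

open Pointwise

variable {k : Type u} [Field k]

theorem locallyOfFiniteType_power (X : Over (Spec (.of k))) [LocallyOfFiniteType X.hom] (n : ℕ) :
    LocallyOfFiniteType (power X n).hom := by
  induction n with
  | zero => exact inferInstanceAs (LocallyOfFiniteType (𝟙 (Spec (.of k))))
  | succ n ih =>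
    change LocallyOfFiniteType (power X n ⊗ X).hom
    dsimp
    infer_instance

theorem lift_comp_conv {S : Scheme.{u}} {T X Y G : Over S} [GrpObj G] (p : T ⟶ X) (q : T ⟶ Y)
    (φ : X ⟶ G) (ψ : Y ⟶ G) : lift p q ≫ conv φ ψ = (p ≫ φ) * (q ≫ ψ) := by
  rw [conv, lift_map_assoc, Hom.mul_def]

section Translation

variable {G : Over (Spec (.of k))} [GrpObj G]

/-- Left translation by a rational point. -/
def leftTranslation (g : 𝟙_ (Over (Spec (.of k))) ⟶ G) : G ≅ G where
  hom := lift (toUnit G ≫ g) (𝟙 G) ≫ μ[G]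
  inv := lift (toUnit G ≫ g⁻¹) (𝟙 G) ≫ μ[G]
  hom_inv_id := by
    rw [comp_lift_assoc, ← Category.assoc _ (toUnit G), comp_toUnit, Category.comp_id]
    change (toUnit G ≫ g⁻¹) * ((toUnit G ≫ g) * 𝟙 G) = 𝟙 G
    rw [GrpObj.comp_inv, inv_mul_cancel_left]
  inv_hom_id := by
    rw [comp_lift_assoc, ← Category.assoc _ (toUnit G), comp_toUnit, Category.comp_id]
    change (toUnit G ≫ g) * ((toUnit G ≫ g⁻¹) * 𝟙 G) = 𝟙 G
    rw [GrpObj.comp_inv, mul_inv_cancel_left]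

theorem isClosed_cosetSet {H : Over (Spec (.of k))} (i : H ⟶ G) [IsClosedImmersion i.left]
    (g : 𝟙_ (Over (Spec (.of k))) ⟶ G) : IsClosed (cosetSet i g) := by
  have h : lift (toUnit H ≫ g) i ≫ μ[G] = i ≫ (leftTranslation g).hom := by
    rw [leftTranslation, comp_lift_assoc, ← Category.assoc, comp_toUnit, Category.comp_id]
  have : IsClosedImmersion (i ≫ (leftTranslation g).hom).left := by
    have : IsIso (leftTranslation g).hom.left :=
      inferInstanceAs (IsIso ((Over.forget _).map (leftTranslation g).hom))
    exact inferInstanceAs (IsClosedImmersion (i.left ≫ (leftTranslation g).hom.left))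
  rw [cosetSet, h]
  exact (i ≫ (leftTranslation g).hom).left.isClosedEmbedding.isClosed_range

end Translation

variable [IsAlgClosed k] {X G : Over (Spec (.of k))} [GrpObj G] [LocallyOfFiniteType X.hom]

/-- The image of the rational points of an irreducible component of `Xⁿ` under the convolution
power `φⁿ` contains a product of `n` images of irreducible components of `X`. -/
theorem exists_list_prod_subset_image_convPower [IsCommMonObj G] (φ : X ⟶ G) (n : ℕ) :
    ∀ Z ∈ irreducibleComponents (power X n).left, ∃ l : List (irreducibleComponents X.left),
      l.length = n ∧
      (l.map fun C : irreducibleComponents X.left ↦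
        (· ≫ φ) '' (evalPoint (X := X) ⁻¹' (C : Set X.left))).prod ⊆
        (· ≫ convPower φ n) '' (evalPoint (X := power X n) ⁻¹' Z) := by
  have hlft := locallyOfFiniteType_power X
  induction n with
  | zero =>
    intro Z hZ
    have := hlft 0
    obtain ⟨p, hp⟩ := exists_evalPoint_mem (X := power X 0)
      (isClosed_of_mem_irreducibleComponents Z hZ).isLocallyClosed hZ.1.1
    refine ⟨[], rfl, ?_⟩
    rw [List.map_nil, List.prod_nil, Set.one_subset]
    exact ⟨p, hp, toUnit_unique p (toUnit _) ▸ rfl⟩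
  | succ n ih =>
    intro Z hZ
    have := hlft n
    obtain ⟨A, hA, B, hB, hAB⟩ :=
      exists_irreducibleComponents_lift_mem (X := power X n) (Y := X) hZ
    obtain ⟨l, hl, hsub⟩ := ih A hA
    refine ⟨⟨B, hB⟩ :: l, by simp [hl], ?_⟩
    -- The list grows on the left, `convPower` on the right; commutativity reconciles them.
    rw [List.map_cons, List.prod_cons, _root_.mul_comm]
    refine (Set.mul_subset_mul_right hsub).trans ?_
    rintro _ ⟨_, ⟨p, hp, rfl⟩, _, ⟨q, hq, rfl⟩, rfl⟩
    exact ⟨lift p q, hAB p q hp hq, lift_comp_conv p q _ _⟩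

/-- To show that a closed subset of `X` is mapped into a coset, it suffices to consider its rational
points. -/
theorem image_subset_cosetSet_of_points (φ : X ⟶ G) {H : Over (Spec (.of k))} (i : H ⟶ G)
    [IsClosedImmersion i.left] (g : 𝟙_ (Over (Spec (.of k))) ⟶ G) {Z : Set X.left}
    (hZ : IsClosed Z) (h : ∀ p, evalPoint p ∈ Z → ∃ q : 𝟙_ _ ⟶ H, g * (q ≫ i) = p ≫ φ) :
    φ.left '' Z ⊆ cosetSet i g := by
  rw [Set.image_subset_iff, ← closure_image_evalPoint_preimage hZ]
  refine closure_minimal ?_ ((isClosed_cosetSet i g).preimage φ.left.continuous)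
  rintro _ ⟨p, hp, rfl⟩
  obtain ⟨q, hq⟩ := h p hp
  refine ⟨evalPoint q, ?_⟩
  rw [← evalPoint_comp, ← evalPoint_comp, ← hq, Hom.mul_def, comp_lift_assoc,
    ← Category.assoc q, toUnit_unique (q ≫ toUnit H) (𝟙 _), Category.id_comp]

variable [LocallyOfFiniteType G.hom]

/-- Some convolution power of a morphism, all of whose restrictions to irreducible components are
generating, is dominant on every irreducible component. -/
theorem exists_dense_image_convPower [IsCommMonObj G] [QuasiCompact X.hom] [QuasiCompact G.hom]
    (φ : X ⟶ G) (hφ : ∀ Z ∈ irreducibleComponents X.left, ∀ (H : Over (Spec (.of k))) [GrpObj H]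
      (i : H ⟶ G) [IsMonHom i] [IsClosedImmersion i.left], ¬ IsIso i →
      ∀ g : 𝟙_ (Over (Spec (.of k))) ⟶ G, ¬ φ.left '' Z ⊆ cosetSet i g) :
    ∃ n : ℕ, 0 < n ∧
      ∀ Z ∈ irreducibleComponents (power X n).left, Dense ((convPower φ n).left '' Z) := by
  have := isNoetherian_of_locallyOfFiniteType X
  have : Finite (irreducibleComponents X.left) :=
    TopologicalSpace.NoetherianSpace.finite_irreducibleComponents
  have hirr (C : irreducibleComponents X.left) :
      IsIrreducible ((· ≫ φ) '' (evalPoint (X := X) ⁻¹' (C : Set X.left))) :=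
    (isIrreducible_preimage_evalPoint (isClosed_of_mem_irreducibleComponents _ C.2) C.2.1).image _
      (continuous_comp_points φ).continuousOn
  obtain ⟨n, hn, h⟩ := exists_dense_list_prod
    (fun C : irreducibleComponents X.left ↦
      (· ≫ φ) '' (evalPoint (X := X) ⁻¹' (C : Set X.left))) (fun C ↦ (hirr C).1) fun C ↦ by
    refine exists_dense_pow_of_isIrreducible
      (exists_forall_ge_eq_of_isIrreducible_points 1) (hirr C) fun H hH hne g hsub ↦ ?_
    obtain ⟨H', _, i, _, _, hi⟩ := exists_closedSubgroupScheme H hH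
    refine hφ C C.2 H' i (fun _ ↦ hne ?_) g ?_
    · exact eq_top_iff.mpr fun p _ ↦ (hi p).mpr ⟨p ≫ inv i, by simp⟩
    · refine image_subset_cosetSet_of_points φ i g
        (isClosed_of_mem_irreducibleComponents _ C.2) fun p hp ↦ ?_
      obtain ⟨x, hx, hxp⟩ := hsub ⟨p, hp, rfl⟩
      obtain ⟨q, rfl⟩ := (hi x).mp hx
      exact ⟨q, hxp⟩
  refine ⟨n, hn, fun Z hZ ↦ ?_⟩
  have := locallyOfFiniteType_power X n
  obtain ⟨l, hl, hsub⟩ := exists_list_prod_subset_image_convPower φ n Z hZ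
  refine (dense_image_evalPoint ((h l hl).mono hsub)).mono ?_
  rintro _ ⟨_, ⟨p, hp, rfl⟩, rfl⟩
  exact ⟨_, hp, (evalPoint_comp p _).symm⟩

end ConvPower

/-! ### Descent to the base field. -/

section BaseChange

variable {K : Type u} [Field K]

/-- Convolution powers commute with base change. -/
theorem exists_iso_power_geom {X G : Over (Spec (.of K))} [GrpObj G] (φ : X ⟶ G) (n : ℕ) :
    ∃ e : power ((geom K).obj X) n ≅ (geom K).obj (power X n),
      e.hom ≫ (geom K).map (convPower φ n) = convPower ((geom K).map φ) n := by
  induction n with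
  | zero => exact ⟨Functor.Monoidal.εIso (geom K), rfl⟩
  | succ n ih =>
    obtain ⟨e, he⟩ := ih
    refine ⟨(e ⊗ᵢ Iso.refl _) ≪≫ Functor.Monoidal.μIso (geom K) _ _, ?_⟩
    change ((e.hom ⊗ₘ 𝟙 _) ≫ Functor.LaxMonoidal.μ (geom K) _ _) ≫
      (geom K).map ((convPower φ n ⊗ₘ φ) ≫ μ[G]) =
        (convPower ((geom K).map φ) n ⊗ₘ (geom K).map φ) ≫
          Functor.LaxMonoidal.μ (geom K) G G ≫ (geom K).map μ[G]
    rw [Functor.map_comp, Category.assoc, ← Functor.LaxMonoidal.μ_natural_assoc,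
      tensorHom_comp_tensorHom_assoc, he, Category.id_comp]

theorem image_mem_irreducibleComponents_of_homeomorph {X Y : Type*} [TopologicalSpace X]
    [TopologicalSpace Y] (e : X ≃ₜ Y) {Z : Set X} (hZ : Z ∈ irreducibleComponents X) :
    e '' Z ∈ irreducibleComponents Y := by
  refine ⟨hZ.1.image e e.continuous.continuousOn, fun W hW hZW ↦ ?_⟩
  have := hZ.2 (hW.image e.symm e.symm.continuous.continuousOn)
    fun z hz ↦ ⟨e z, hZW ⟨z, hz, rfl⟩, e.symm_apply_apply z⟩
  intro w hw
  exact ⟨e.symm w, this ⟨w, hw, rfl⟩, e.apply_symm_apply w⟩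

end BaseChange

end AlgConv

end

theorem mainTheorem7 {K : Type u} [Field K] [CharZero K]
    (X G : Over (Spec (.of K)))
    [Smooth X.hom] [IsSeparated X.hom] [QuasiCompact X.hom]
    [GrpObj G] [IsCommMonObj G] [LocallyOfFiniteType G.hom] [QuasiCompact G.hom]
    (φ : X ⟶ G) (hφ : AlgConv.StronglyGenerating φ) :
    ∃ n : ℕ, 0 < n ∧ AlgConv.StronglyDominant (AlgConv.convPower φ n) := by
  have : LocallyOfFiniteType ((AlgConv.geom K).obj X).hom := by dsimp; infer_instance
  have : QuasiCompact ((AlgConv.geom K).obj X).hom := by dsimp; infer_instance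
  have : LocallyOfFiniteType ((AlgConv.geom K).obj G).hom := by dsimp; infer_instance
  have : QuasiCompact ((AlgConv.geom K).obj G).hom := by dsimp; infer_instance
  have : IsCommMonObj ((AlgConv.geom K).obj G) := inferInstance
  obtain ⟨n, hn, h⟩ := AlgConv.exists_dense_image_convPower ((AlgConv.geom K).map φ) hφ
  refine ⟨n, hn, fun Z hZ ↦ ?_⟩
  obtain ⟨e, he⟩ := AlgConv.exists_iso_power_geom φ n
  -- Density is known on components of the power of the base change; `e` carries it to the base
  -- change of the power.
  have hdense := h _ (AlgConv.image_mem_irreducibleComponents_of_homeomorph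
    (Scheme.homeoOfIso ((Over.forget _).mapIso e.symm)) hZ)
  refine hdense.mono ?_
  rintro _ ⟨_, ⟨z, hz, rfl⟩, rfl⟩
  refine ⟨z, hz, ?_⟩
  have : e.inv ≫ AlgConv.convPower ((AlgConv.geom K).map φ) n =
      (AlgConv.geom K).map (AlgConv.convPower φ n) := by rw [← he, Iso.inv_hom_id_assoc]
  rw [← this]
  rfl
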